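/- **Model.** There are finite sets $\mathcal S$ of students, $\mathcal D$ of districts, $\mathcal C$ of schools and $\mathcal T$ of types. Each student $s$ has a home district $d(s)$ and a type $\tau(s)$; each school $c$ has a district $d(c)$ and a capacity $q_c\in\mathbb Z_{\ge 0}$. Let $k_d$ be the number of students whose home district is $d$, assumed positive for every $d$, and $k^t$ the number of type-$t$ students. A contract $x=(s,d,c)$ consists of a student $s$, a school $c$ and its district $d=d(c)$. For a set $X$ of contracts (a *matching*), $X_d$ and $X_c$ are the contracts of $X$ at district $d$ and at school $c$, $\xi_c^t(X)$ is the number of contracts of $X$ of type-$t$ students at $c$, and $\xi_d^t(X)=\sum_{c:d(c)=d}\xi_c^t(X)$. $X$ is *feasible for students* if it has at most one contract per student, and *feasible* if moreover $|X_c|\le q_c$ for all $c$. Each student $s$ has a strict preference order over all schools, each school being preferred to being unmatched. Each district $d$ has an admissions rule $Ch_d$, a choice function on sets of contracts with $Ch_d(X)=Ch_d(X_d)\subseteq X_d$. Assume that $Ch_d(X)$ is feasible for every $X$, and that $Ch_d$ has a completion satisfying substitutability and the law of aggregate demand; that is, there is an admissions rule $Ch'_d$ such that for every $X$ either $Ch'_d(X)=Ch_d(X)$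 or $Ch'_d(X)$ is not feasible for students, and such that for all $X\subseteq Y$: $X\cap Ch'_d(Y)\subseteq Ch'_d(X)$ and $|Ch'_d(X)|\le|Ch'_d(Y)|$. SPDA is student-proposing deferred acceptance: in each step, every student whose contract is not tentatively held proposes her most preferred contract that has not been rejected, if there is one; each district $d$ considers the set $X_d$ of contracts it holds or has just been proposed, tentatively accepts $Ch_d(X_d)$ and permanently rejects the rest; the contracts accepted in the first step without rejections form the outcome. For $\alpha\in[0,1]$, SPDA satisfies the *$\alpha$-diversity policy* if for all preference profiles, with outcome $X$, all districts $d,d'$ and all types $t$, $\xi_d^t(X)/|X_d|-\xi_{d'}^t(X)/|X_{d'}|\le\alpha$. **Theorem.** Let $q_c^t\in\mathbb Z_{\ge0}$ ($c\in\mathcal C$, $t\in\mathcal T$) be ceilings. Suppose that for every district $d$ and every $X$ that is feasible for students: 1. (school-level type-specific ceilings) $\xi_c^t(Ch_d(X))\le q_c^t$ for all $c,t$; 2. (rationed) $|Ch_d(X)|\le k_d$; 3. (weakly acceptant) if $x=(s,d,c)\in X\setminus Ch_d(X)$ and $t=\tau(s)$, then $|Ch_d(X)_c|=q_c$, or $|Ch_d(X)|\ge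 k_d$, or $\xi_c^t(Ch_d(X))\ge q_c^t$. Suppose also that the profile accommodates unmatched students: for every feasible matching $X$ and every student $s$ unmatched in $X$, there is a contract $x=(s,d,c)$ with $x\in Ch_d(X\cup\{x\})$. Let $\hat p_d^t$ and $\hat q_d^t$ be the minimum and the maximum of $\sum_{c:d(c)=d}y_c^t$ over real $y=(y_c^{t'})\ge 0$ subject to $$\sum_{t'}\sum_{c:d(c)=d'}y_c^{t'}=k_{d'}\ \ \forall d',\qquad \sum_{c}y_c^{t'}=k^{t'}\ \ \forall t',\qquad \sum_{t'}y_c^{t'}\le q_c\ \ \forall c,\qquad y_c^{t'}\le q_c^{t'}\ \ \forall c,t'.$$ These minima and maxima exist, and, for $\alpha\in[0,1]$, SPDA satisfies the $\alpha$-diversity policy if and only if $$\frac{\hat q_d^t}{k_d}-\frac{\hat p_{d'}^t}{k_{d'}}\le\alpha\qquad\text{for every type }t\text{ and all districts }d\ne d'.$$ -/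

import Mathlib

/-- The fixed data of an interdistrict school choice problem with students `S`, districts `D`,
schools `C` and student types `T`. -/
structure Market (S D C T : Type*) where
  /-- the home district `d(s)` of a student -/
  studentDistrict : S → D
  /-- the district `d(c)` of a school -/
  schoolDistrict : C → D
  /-- the type `τ(s)` of a student -/
  studentType : S → T
  /-- the capacity `q_c` of a school -/
  capacity : C → ℕ

/-- A contract `(s, c)`; its district is the district of the school `c`. A matching is a
`Finset` of contracts. -/
abbrev Contract (S C : Type*) := S × C

/-- A strict preference order over all schools; being unmatched is ranked below every school. -/
structure Preference (C : Type*) where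
  /-- `prefers c c'`: school `c` is strictly preferred to school `c'` -/
  prefers : C → C → Prop
  irrefl : ∀ c, ¬ prefers c c
  trans : ∀ a b c, prefers a b → prefers b c → prefers a c
  total : ∀ a b, a ≠ b → prefers a b ∨ prefers b a

namespace Market

variable {S D C T : Type*} [Fintype S] [Fintype D] [Fintype C] [Fintype T]
  [DecidableEq S] [DecidableEq D] [DecidableEq C] [DecidableEq T] (M : Market S D C T)

/-- `k_d`, the number of students whose home district is `d`. -/
def residents (d : D) : ℕ := (Finset.univ.filter fun s : S => M.studentDistrict s = d).card

/-- `k^t`, the number of type-`t` students. -/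
def typeCount (t : T) : ℕ := (Finset.univ.filter fun s : S => M.studentType s = t).card

/-- `X_d`, the contracts of `X` associated with district `d`. -/
def inDistrict (d : D) (X : Finset (Contract S C)) : Finset (Contract S C) :=
  X.filter fun x => M.schoolDistrict x.2 = d

/-- `X_c`, the contracts of `X` associated with school `c`. -/
def inSchool (_M : Market S D C T) (c : C) (X : Finset (Contract S C)) : Finset (Contract S C) :=
  X.filter fun x => x.2 = c

/-- `ξ_c^t(X)`, the number of type-`t` students assigned to school `c` at `X`. -/
def schoolTypeCount (c : C) (t : T) (X : Finset (Contract S C)) : ℕ :=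
  (X.filter fun x => x.2 = c ∧ M.studentType x.1 = t).card

/-- `ξ_d^t(X)`, the number of type-`t` students assigned to district `d` at `X`. -/
def districtTypeCount (d : D) (t : T) (X : Finset (Contract S C)) : ℕ :=
  ∑ c with M.schoolDistrict c = d, M.schoolTypeCount c t X

/-- At most one contract per student. -/
def FeasibleForStudents (_M : Market S D C T) (X : Finset (Contract S C)) : Prop :=
  ∀ x ∈ X, ∀ y ∈ X, x.1 = y.1 → x = y

/-- At most one contract per student, and no school exceeds its capacity. -/
def Feasible (X : Finset (Contract S C)) : Prop :=
  M.FeasibleForStudents X ∧ ∀ c, (M.inSchool c X).card ≤ M.capacity c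

/-- No district is assigned more students than the number of its residents. -/
def Rationed (X : Finset (Contract S C)) : Prop :=
  ∀ d, (M.inDistrict d X).card ≤ M.residents d

/-- An admissions rule of district `d`: a choice function with
`Ch_d(X) = Ch_d(X_d) ⊆ X_d` for every set of contracts `X`. -/
structure AdmissionsRule (d : D) where
  /-- the chosen set `Ch_d(X)` -/
  choose : Finset (Contract S C) → Finset (Contract S C)
  choose_inDistrict : ∀ X, choose (M.inDistrict d X) = choose X
  choose_subset : ∀ X, choose X ⊆ M.inDistrict d X

namespace AdmissionsRule

variable {M} {d : D}

/-- The rule always chooses a feasible matching. -/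
def IsFeasible (f : M.AdmissionsRule d) : Prop :=
  ∀ X, M.Feasible (f.choose X)

/-- Substitutability. -/
def Substitutable (f : M.AdmissionsRule d) : Prop :=
  ∀ X Y, X ⊆ Y → ∀ x ∈ X, x ∈ f.choose Y → x ∈ f.choose X

/-- The law of aggregate demand. -/
def LAD (f : M.AdmissionsRule d) : Prop :=
  ∀ X Y, X ⊆ Y → (f.choose X).card ≤ (f.choose Y).card

/-- `g` is a completion of `f`: whenever `g` differs from `f`, it chooses a matching that is not
feasible for students. -/
def IsCompletion (g f : M.AdmissionsRule d) : Prop :=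
  ∀ X, g.choose X = f.choose X ∨ ¬ M.FeasibleForStudents (g.choose X)

/-- The rule has a completion that satisfies substitutability and LAD. -/
def HasGoodCompletion (f : M.AdmissionsRule d) : Prop :=
  ∃ g : M.AdmissionsRule d, g.IsCompletion f ∧ g.Substitutable ∧ g.LAD

/-- From any matching that is feasible for students, the rule chooses a rationed matching. -/
def IsRationed (f : M.AdmissionsRule d) : Prop :=
  ∀ X, M.FeasibleForStudents X → M.Rationed (f.choose X)

/-- The rule has the school-level type-specific ceilings `ceil c t`. -/
def HasCeilings (f : M.AdmissionsRule d) (ceil : C → T → ℕ) : Prop :=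
  ∀ X, M.FeasibleForStudents X → ∀ c t, M.schoolTypeCount c t (f.choose X) ≤ ceil c t

/-- Weak acceptance with respect to the ceilings `ceil c t`: a contract may be rejected from a
matching that is feasible for students only if its school is full, the district has accepted at
least as many students as it has residents, or the ceiling for the student's type is reached at
the school. -/
def WeaklyAcceptant (f : M.AdmissionsRule d) (ceil : C → T → ℕ) : Prop :=
  ∀ X, M.FeasibleForStudents X → ∀ x ∈ M.inDistrict d X, x ∉ f.choose X →
    (M.inSchool x.2 (f.choose X)).card = M.capacity x.2 ∨
    M.residents d ≤ (M.inDistrict d (f.choose X)).card ∨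
    ceil x.2 (M.studentType x.1) ≤ M.schoolTypeCount x.2 (M.studentType x.1) (f.choose X)

end AdmissionsRule

variable {M}

/-- The profile of rules accommodates unmatched students: whenever a student is unmatched at a
feasible matching, some contract of hers would be chosen if it were added. -/
def AccommodatesUnmatched (Ch : ∀ d, M.AdmissionsRule d) : Prop :=
  ∀ (s : S) (X : Finset (Contract S C)), M.Feasible X → (∀ x ∈ X, x.1 ≠ s) →
    ∃ c : C, (s, c) ∈ (Ch (M.schoolDistrict c)).choose (insert (s, c) X)

/-- The state of student-proposing deferred acceptance between two steps. -/
structure DAState (S C : Type*) where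
  /-- contracts that are tentatively accepted -/
  held : Finset (Contract S C)
  /-- contracts that have been permanently rejected -/
  rejected : Finset (Contract S C)

/-- The new proposals of a step: each student without a tentatively accepted contract proposes her
most preferred contract among those that have not been rejected (if there is one). -/
noncomputable def newProposals (P : S → Preference C) (st : DAState S C) :
    Finset (Contract S C) :=
  open scoped Classical in
  Finset.univ.filter fun x =>
    (∀ y ∈ st.held, y.1 ≠ x.1) ∧ x ∉ st.rejected ∧
      ∀ c, c ≠ x.2 → (x.1, c) ∉ st.rejected → (P x.1).prefers x.2 c

/-- All contracts under consideration in a step: those held and the new proposals. -/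
noncomputable def considered (P : S → Preference C) (st : DAState S C) : Finset (Contract S C) :=
  st.held ∪ newProposals P st

/-- The contracts accepted in a step, `⋃_d Ch_d(X_d)` for the considered contracts `X`. -/
noncomputable def accepted (Ch : ∀ d, M.AdmissionsRule d) (P : S → Preference C)
    (st : DAState S C) : Finset (Contract S C) :=
  Finset.univ.biUnion fun d => (Ch d).choose (M.inDistrict d (considered P st))

/-- The contracts rejected in a step. -/
noncomputable def rejections (Ch : ∀ d, M.AdmissionsRule d) (P : S → Preference C)
    (st : DAState S C) : Finset (Contract S C) :=
  considered P st \ accepted Ch P st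

/-- The state after `n` steps. -/
noncomputable def daState (Ch : ∀ d, M.AdmissionsRule d) (P : S → Preference C) :
    ℕ → DAState S C
  | 0 => ⟨∅, ∅⟩
  | n + 1 =>
    ⟨accepted Ch P (daState Ch P n),
      (daState Ch P n).rejected ∪ rejections Ch P (daState Ch P n)⟩

theorem accepted_subset_considered (Ch : ∀ d, M.AdmissionsRule d) (P : S → Preference C)
    (st : DAState S C) : accepted Ch P st ⊆ considered P st := by
  intro x hx
  simp only [accepted, Finset.mem_biUnion] at hx
  obtain ⟨d, -, hx⟩ := hx
  have h := (Ch d).choose_subset _ hx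
  simp only [inDistrict, Finset.mem_filter] at h
  exact h.1.1

theorem considered_disjoint_rejected (Ch : ∀ d, M.AdmissionsRule d) (P : S → Preference C)
    (n : ℕ) : Disjoint (considered P (daState Ch P n)) (daState Ch P n).rejected := by
  have key : ∀ st : DAState S C, Disjoint st.held st.rejected →
      Disjoint (considered P st) st.rejected := by
    intro st h
    rw [considered, Finset.disjoint_union_left]
    refine ⟨h, Finset.disjoint_left.2 fun x hx => ?_⟩
    simp only [newProposals, Finset.mem_filter] at hx
    exact hx.2.2.1
  induction n with
  | zero => exact key _ (by simp [daState])
  | succ n ih =>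
    refine key _ ?_
    rw [daState, Finset.disjoint_union_right]
    exact ⟨ih.mono_left (accepted_subset_considered Ch P _), Finset.disjoint_sdiff⟩

/-- The algorithm reaches a step without rejections. -/
theorem exists_no_rejections (Ch : ∀ d, M.AdmissionsRule d) (P : S → Preference C) :
    ∃ n, rejections Ch P (daState Ch P n) = ∅ := by
  by_contra! h
  have grow : ∀ n, n ≤ (daState Ch P n).rejected.card := by
    intro n
    induction n with
    | zero => exact Nat.zero_le _
    | succ n ih =>
      have hd : Disjoint (daState Ch P n).rejected (rejections Ch P (daState Ch P n)) :=
        (considered_disjoint_rejected Ch P n).symm.mono_right Finset.sdiff_subset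
      have hp := Finset.card_pos.2 (h n)
      rw [daState, Finset.card_union_of_disjoint hd]
      omega
  have h1 := grow (Fintype.card (Contract S C) + 1)
  have h2 := Finset.card_le_univ (daState Ch P (Fintype.card (Contract S C) + 1)).rejected
  omega

open scoped Classical in
/-- The outcome of student-proposing deferred acceptance: the contracts accepted in the first
step without rejections. -/
noncomputable def SPDA (Ch : ∀ d, M.AdmissionsRule d) (P : S → Preference C) :
    Finset (Contract S C) :=
  accepted Ch P (daState Ch P (Nat.find (exists_no_rejections Ch P)))

variable (M)

/-- The ratio of type-`t` students among the students assigned to district `d` at `X`. -/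
noncomputable def typeRatio (d : D) (t : T) (X : Finset (Contract S C)) : ℝ :=
  (M.districtTypeCount d t X : ℝ) / ((M.inDistrict d X).card : ℝ)

/-- The `α`-diversity policy for a mechanism `φ`. -/
def SatisfiesDiversity (α : ℝ) (φ : (S → Preference C) → Finset (Contract S C)) : Prop :=
  ∀ (P : S → Preference C) (d d' : D) (t : T),
    M.typeRatio d t (φ P) - M.typeRatio d' t (φ P) ≤ α

/-- The constraints of the linear program. -/
structure LPFeasible (ceil : C → T → ℕ) (y : C → T → ℝ) : Prop where
  nonneg : ∀ c t, 0 ≤ y c t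
  district_total : ∀ d, ∑ t, ∑ c with M.schoolDistrict c = d, y c t = M.residents d
  type_total : ∀ t, ∑ c, y c t = M.typeCount t
  capacity_le : ∀ c, ∑ t, y c t ≤ M.capacity c
  ceiling_le : ∀ c t, y c t ≤ ceil c t

/-- The values of the objective `∑_{c : d(c) = d} y_c^t` over the feasible points of the linear
program. -/
def lpValues (ceil : C → T → ℕ) (d : D) (t : T) : Set ℝ :=
  {v | ∃ y, M.LPFeasible ceil y ∧ v = ∑ c with M.schoolDistrict c = d, y c t}

/-- The implied floor `p̂_d^t`, the value of the minimization problem. -/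
noncomputable def impliedFloor (ceil : C → T → ℕ) (d : D) (t : T) : ℝ :=
  sInf (M.lpValues ceil d t)

/-- The implied ceiling `q̂_d^t`, the value of the maximization problem. -/
noncomputable def impliedCeiling (ceil : C → T → ℕ) (d : D) (t : T) : ℝ :=
  sSup (M.lpValues ceil d t)

end Market

/-!
The constraints of the linear program describe a flow that runs from the types through the schools
to the districts. Its integral points are exactly the numbers `ξ_c^t(X)` at the outcomes `X` of
deferred acceptance under the various preference profiles.

*Outcomes are feasible points.* A good completion satisfies the irrelevance of rejected contracts,
so it keeps rejecting a once rejected contract from the growing set of all contracts considered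
(`notMem_choose_of_mem_rejected`). A student left unmatched would have been rejected by every
school, and then no school would take her if her contract were added to the outcome, contrary to
the accommodation of unmatched students (`SPDA_matches_all`). As all students are matched and no
district exceeds the number `k_d` of its residents, every district gets exactly `k_d` students; the
remaining constraints are the capacities and the ceilings (`SPDA_integralFeasible`).

*Integral points are outcomes.* An integral point is the vector of counts of some matching. If every
student ranks her school in that matching first, then all of these contracts are proposed in the
first step, and by weak acceptance none is rejected (`IntegralFeasible.exists_SPDA`).

*Optima.* Let `x` be an integral and `y` a real feasible point, and suppose that `y` has fewer (more)
type-`t` students in a district than `x`. The difference `y - x` is a circulation, and following it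
from the corresponding node yields an integral exchange: `x` can be changed, by at most one unit on
every arc and always towards `y`, so that exactly one type-`t` student leaves (enters) that district
and one enters (leaves) another district, in which `y` has more (fewer) type-`t` students than `x`
(`exists_unit_flow`, `IntegralFeasible.exists_lower`, `IntegralFeasible.exists_raise`). Hence the
optima over integral points are optima over all real points; in particular they are attained.
Moreover, among the integral points with the most type-`t` students in `d`, one with the fewest in
`d'` also attains the overall minimum for `d'`, since the exchange that would improve it raises a
district other than `d` (`IntegralFeasible.exists_max_min`).

So the ratios at any outcome lie between `p̂_d^t / k_d` and `q̂_d^t / k_d`, and for `d ≠ d'` the upper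
bound for `d` and the lower bound for `d'` are attained at one and the same outcome.
-/

set_option linter.unusedSectionVars false

namespace Market

/-! ### Unit flows conforming to a real flow -/

/-- The net outflow of `f` at the node `p`, in the directed multigraph whose arc `a` runs from
`src a` to `tgt a`. -/
def netOutflow {V A R : Type*} [Fintype A] [DecidableEq V] [AddCommGroup R] (src tgt : A → V)
    (f : A → R) (p : V) : R :=
  ∑ a, ((if src a = p then f a else 0) - (if tgt a = p then f a else 0))

/-- The integer `n` is `-1`, `0` or `1`, and if nonzero it has the same sign as the real `r`. -/
structure ConformsTo (n : ℤ) (r : ℝ) : Prop where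
  neg_one_le : -1 ≤ n
  le_one : n ≤ 1
  pos : 0 < n → 0 < r
  neg : n < 0 → r < 0

theorem ConformsTo.zero (r : ℝ) : ConformsTo 0 r :=
  ⟨by norm_num, by norm_num, fun h => absurd h (lt_irrefl _), fun h => absurd h (lt_irrefl _)⟩

theorem ConformsTo.negate {n : ℤ} {r : ℝ} (h : ConformsTo n r) : ConformsTo (-n) (-r) :=
  ⟨by linarith [h.le_one], by linarith [h.neg_one_le],
    fun hn => neg_pos.2 (h.neg (by omega)), fun hn => neg_neg_iff_pos.2 (h.pos (by omega))⟩

/-- A conforming step from an integer towards a real number does not overshoot an integral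
upper bound of that real number. -/
theorem ConformsTo.add_le {n m u : ℤ} {r : ℝ} (h : ConformsTo n (r - m)) (hm : (m : ℝ) ≤ u)
    (hr : r ≤ u) : ((m + n : ℤ) : ℝ) ≤ u := by
  have hm' : m ≤ u := by exact_mod_cast hm
  have h1 := h.le_one
  have : m + n ≤ u := by
    rcases le_or_gt n 0 with hn | hn
    · omega
    · have : (m : ℝ) < u := by linarith [h.pos hn]
      have : m < u := by exact_mod_cast this
      omega
  exact_mod_cast this

theorem ConformsTo.le_add {n m l : ℤ} {r : ℝ} (h : ConformsTo n (r - m)) (hm : (l : ℝ) ≤ m)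
    (hr : l ≤ r) : (l : ℝ) ≤ ((m + n : ℤ) : ℝ) := by
  have hm' : l ≤ m := by exact_mod_cast hm
  have h1 := h.neg_one_le
  have : l ≤ m + n := by
    rcases le_or_gt 0 n with hn | hn
    · omega
    · have : (l : ℝ) < m := by linarith [h.neg hn]
      have : l < m := by exact_mod_cast this
      omega
  exact_mod_cast this

section Flow

variable {V A : Type*} [Fintype A] [DecidableEq V]

theorem netOutflow_add {R : Type*} [AddCommGroup R] (src tgt : A → V) (f g : A → R) (p : V) :
    netOutflow src tgt (f + g) p = netOutflow src tgt f p + netOutflow src tgt g p := by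
  simp only [netOutflow, ← Finset.sum_add_distrib, Pi.add_apply]
  refine Finset.sum_congr rfl fun a _ => ?_
  split_ifs <;> abel

theorem netOutflow_single [DecidableEq A] (src tgt : A → V) (a : A) (n : ℤ) (p : V) :
    netOutflow src tgt (Pi.single a n) p =
      (if src a = p then n else 0) - (if tgt a = p then n else 0) := by
  rw [netOutflow, Finset.sum_eq_single a]
  · simp
  · intro b _ hb
    simp [Pi.single_eq_of_ne hb]
  · simp

theorem sum_netOutflow {R : Type*} [AddCommGroup R] (src tgt : A → V) (f : A → R)
    (B : Finset V) :
    ∑ p ∈ B, netOutflow src tgt f p =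
      ∑ a, ((if src a ∈ B then f a else 0) - (if tgt a ∈ B then f a else 0)) := by
  simp only [netOutflow]
  rw [Finset.sum_comm]
  refine Finset.sum_congr rfl fun a _ => ?_
  rw [Finset.sum_sub_distrib]
  simp

/-- The step of a flow decomposition: from a node `v` at which the real flow `w` has a positive
net outflow, a unit of flow can be sent, along arcs on which `w` is nonzero and in the direction
of `w`, to a node `u` at which `w` has a negative net outflow. -/
theorem exists_unit_flow [Fintype V] (src tgt : A → V) (w : A → ℝ) (v : V)
    (hv : 0 < netOutflow src tgt w v) :
    ∃ u, netOutflow src tgt w u < 0 ∧ ∃ f : A → ℤ, (∀ a, ConformsTo (f a) (w a)) ∧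
      ∀ p, netOutflow src tgt f p = (if v = p then 1 else 0) - (if u = p then 1 else 0) := by
  classical
  -- `good B`: every node of `B` is reached from `v` by a unit flow inside `B`.
  let good : Finset V → Prop := fun B => v ∈ B ∧ ∀ u ∈ B, ∃ f : A → ℤ,
    (∀ a, ConformsTo (f a) (w a)) ∧ (∀ a, f a ≠ 0 → src a ∈ B ∧ tgt a ∈ B) ∧
      ∀ p, netOutflow src tgt f p = (if v = p then 1 else 0) - (if u = p then 1 else 0)
  have hgood : good {v} := by
    refine ⟨by simp, fun u hu => ⟨0, fun a => .zero _, by simp, fun p => ?_⟩⟩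
    obtain rfl := Finset.mem_singleton.1 hu
    simp [netOutflow]
  obtain ⟨B, hB, hmax⟩ := Finset.exists_max_image (Finset.univ.filter good) Finset.card
    ⟨_, Finset.mem_filter.2 ⟨Finset.mem_univ _, hgood⟩⟩
  have hB : good B := (Finset.mem_filter.1 hB).2
  -- By maximality, `w` carries no flow out of `B`: the end of such an arc could be added to `B`.
  have extend : ∀ (a : A) (n : ℤ) (q p : V), q ∈ B → p ∉ B → ConformsTo n (w a) →
      (src a = q ∧ tgt a = p ∧ n = 1 ∨ tgt a = q ∧ src a = p ∧ n = -1) → False := by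
    intro a n q p hq hp hn ha
    have hends : src a ∈ insert p B ∧ tgt a ∈ insert p B := by
      rcases ha with ⟨h1, h2, -⟩ | ⟨h1, h2, -⟩ <;> simp [h1, h2, hq]
    have hout : ¬ (src a ∈ B ∧ tgt a ∈ B) := by
      rcases ha with ⟨h1, h2, -⟩ | ⟨h1, h2, -⟩ <;> simp [h1, h2, hp]
    have hg : good (insert p B) := by
      refine ⟨Finset.mem_insert_of_mem hB.1, fun u hu => ?_⟩
      rcases Finset.mem_insert.1 hu with rfl | hu
      · obtain ⟨f, hf1, hf2, hf3⟩ := hB.2 q hq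
        have hfa : f a = 0 := by
          by_contra h
          exact hout (hf2 a h)
        refine ⟨f + Pi.single a n, fun b => ?_, fun b hb => ?_, fun r => ?_⟩
        · by_cases hb : b = a
          · subst hb
            simpa [hfa] using hn
          · simpa [Pi.single_eq_of_ne hb] using hf1 b
        · by_cases hba : b = a
          · subst hba
            exact hends
          · have := hf2 b (by simpa [Pi.single_eq_of_ne hba] using hb)
            exact ⟨Finset.mem_insert_of_mem this.1, Finset.mem_insert_of_mem this.2⟩
        · rw [netOutflow_add, netOutflow_single, hf3]
          rcases ha with ⟨h1, h2, h3⟩ | ⟨h1, h2, h3⟩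
          · rw [h1, h2, h3]
            ring
          · rw [h1, h2, h3]
            split_ifs <;> ring
      · obtain ⟨f, hf1, hf2, hf3⟩ := hB.2 u hu
        exact ⟨f, hf1, fun a ha => ⟨Finset.mem_insert_of_mem (hf2 a ha).1,
          Finset.mem_insert_of_mem (hf2 a ha).2⟩, hf3⟩
    have := hmax _ (Finset.mem_filter.2 ⟨Finset.mem_univ _, hg⟩)
    rw [Finset.card_insert_of_notMem hp] at this
    omega
  have hsum : ∑ p ∈ B, netOutflow src tgt w p ≤ 0 := by
    rw [sum_netOutflow]
    refine Finset.sum_nonpos fun a _ => ?_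
    by_cases h1 : src a ∈ B <;> by_cases h2 : tgt a ∈ B <;> simp only [h1, h2, if_true, if_false]
    · simp
    · by_contra! h
      exact extend a 1 _ _ h1 h2 ⟨by norm_num, le_rfl, fun _ => by linarith,
        fun h => by norm_num at h⟩ (Or.inl ⟨rfl, rfl, rfl⟩)
    · by_contra! h
      exact extend a (-1) _ _ h2 h1 ⟨le_rfl, by norm_num, fun h => by norm_num at h,
        fun _ => by linarith⟩ (Or.inr ⟨rfl, rfl, rfl⟩)
    · simp
  obtain ⟨u, hu, hneg⟩ : ∃ u ∈ B, netOutflow src tgt w u < 0 := by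
    by_contra! h
    exact absurd (Finset.single_le_sum h hB.1) (by linarith)
  obtain ⟨f, hf1, -, hf3⟩ := hB.2 u hu
  exact ⟨u, hneg, f, hf1, hf3⟩

end Flow

end Market

namespace Market

/-! ### Exchanges between feasible points of the linear program -/

section Exchange

variable {S D C T : Type*} [Fintype C] [DecidableEq D] (M : Market S D C T)

/-- The number of type-`t` students that `y` assigns to the schools of district `d`: the objective
of the linear program. -/
def load {R : Type*} [AddCommMonoid R] (d : D) (t : T) (y : C → T → R) : R :=
  ∑ c with M.schoolDistrict c = d, y c t

theorem load_add {R : Type*} [AddCommMonoid R] (d : D) (t : T) (y z : C → T → R) :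
    M.load d t (y + z) = M.load d t y + M.load d t z := by
  simp [load, Finset.sum_add_distrib]

theorem load_neg {R : Type*} [AddCommGroup R] (d : D) (t : T) (y : C → T → R) :
    M.load d t (-y) = -M.load d t y := by
  simp [load]

theorem load_intCast (d : D) (t : T) (x : C → T → ℤ) :
    M.load d t (fun c t => (x c t : ℝ)) = (M.load d t x : ℤ) := by
  simp [load]

variable [Fintype T]

/-- `γ` moves from an integral point towards the displacement `w` by at most one unit in every
entry and in the total of every school, and leaves the totals of all districts and of all types
unchanged. -/
structure IsConformingMove (γ : C → T → ℤ) (w : C → T → ℝ) : Prop where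
  entry : ∀ c t, ConformsTo (γ c t) (w c t)
  school : ∀ c, ConformsTo (∑ t, γ c t) (∑ t, w c t)
  district : ∀ d, ∑ t, ∑ c with M.schoolDistrict c = d, γ c t = 0
  type : ∀ t, ∑ c, γ c t = 0

variable {M}

theorem IsConformingMove.negate {γ : C → T → ℤ} {w : C → T → ℝ} (h : M.IsConformingMove γ w) :
    M.IsConformingMove (-γ) (-w) where
  entry c t := (h.entry c t).negate
  school c := by simpa using (h.school c).negate
  district d := by simpa using h.district d
  type t := by simpa using h.type t

variable (M) [DecidableEq C] [DecidableEq T]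

/-- The tail of an arc of the network in which student flow runs from the types through the
schools to the districts. Arcs are pairs `(c, t)` and schools `c`; nodes are schools, districts,
types, and, last, one copy of the distinguished type `t₀` for every district. Splitting the node
of `t₀` in this way makes its assignment to each district the net outflow of a node. -/
def arcSource (t₀ : T) : (C × T) ⊕ C → C ⊕ D ⊕ T ⊕ D
  | .inl (c, t) => if t = t₀ then .inr (.inr (.inr (M.schoolDistrict c))) else .inr (.inr (.inl t))
  | .inr c => .inl c

/-- The head of an arc of the network of `Market.arcSource`. -/
def arcTarget : (C × T) ⊕ C → C ⊕ D ⊕ T ⊕ D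
  | .inl (c, _) => .inl c
  | .inr c => .inr (.inl (M.schoolDistrict c))

section Outflow

variable {R : Type*} [AddCommGroup R] (t₀ : T) (f : (C × T) ⊕ C → R)

theorem netOutflow_school (c : C) :
    netOutflow (M.arcSource t₀) M.arcTarget f (.inl c) = f (.inr c) - ∑ t, f (.inl (c, t)) := by
  rw [netOutflow, Fintype.sum_sum_type, Fintype.sum_prod_type]
  have h : ∀ c' t, M.arcSource t₀ (.inl (c', t)) ≠ .inl c := by
    intro c' t
    simp only [arcSource]
    split_ifs <;> simp
  simp only [h, if_false]
  simp only [arcSource, arcTarget, Sum.inl.injEq, reduceCtorEq, if_false, zero_sub, sub_zero,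
    Finset.sum_ite_eq', Finset.mem_univ, if_true]
  rw [Finset.sum_eq_single c]
  · simp [sub_eq_add_neg, add_comm]
  · intro b _ hb
    simp [hb]
  · simp

theorem netOutflow_district (d : D) :
    netOutflow (M.arcSource t₀) M.arcTarget f (.inr (.inl d)) =
      -∑ c with M.schoolDistrict c = d, f (.inr c) := by
  rw [netOutflow, Fintype.sum_sum_type, Fintype.sum_prod_type]
  have h : ∀ c' t, M.arcSource t₀ (.inl (c', t)) ≠ .inr (.inl d) := by
    intro c' t
    simp only [arcSource]
    split_ifs <;> simp
  simp only [h, if_false]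
  simp [arcSource, arcTarget, Finset.sum_filter]

theorem netOutflow_type (t : T) :
    netOutflow (M.arcSource t₀) M.arcTarget f (.inr (.inr (.inl t))) =
      if t = t₀ then 0 else ∑ c, f (.inl (c, t)) := by
  rw [netOutflow, Fintype.sum_sum_type, Fintype.sum_prod_type]
  have h : ∀ c' t', M.arcSource t₀ (.inl (c', t')) = .inr (.inr (.inl t)) ↔ t' = t ∧ t ≠ t₀ := by
    intro c' t'
    simp only [arcSource]
    split_ifs with h1
    · subst h1
      simp
      tauto
    · simp
      rintro rfl
      exact h1
  simp only [h]
  by_cases ht : t = t₀ <;> simp [ht, arcSource, arcTarget]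

theorem netOutflow_typeDistrict (d : D) :
    netOutflow (M.arcSource t₀) M.arcTarget f (.inr (.inr (.inr d))) =
      M.load d t₀ fun c t => f (.inl (c, t)) := by
  rw [netOutflow, Fintype.sum_sum_type, Fintype.sum_prod_type]
  have h : ∀ c' t', M.arcSource t₀ (.inl (c', t')) = .inr (.inr (.inr d)) ↔
      t' = t₀ ∧ M.schoolDistrict c' = d := by
    intro c' t'
    simp only [arcSource]
    split_ifs with h1 <;> simp [h1]
  simp only [h]
  simp [arcSource, arcTarget, load, Finset.sum_filter, ite_and]

end Outflow

variable [Fintype D]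

theorem sum_load {R : Type*} [AddCommMonoid R] (t : T) (y : C → T → R) :
    ∑ d, M.load d t y = ∑ c, y c t :=
  Finset.sum_fiberwise _ _ _

/-- If a displacement `w` that preserves all totals raises the number of type-`t` students in
district `d`, then some conforming move shifts exactly one type-`t` student to `d`, from a district
in which `w` lowers that number. -/
theorem exists_conformingMove_of_pos (w : C → T → ℝ)
    (hD : ∀ d, ∑ t, ∑ c with M.schoolDistrict c = d, w c t = 0) (hT : ∀ t, ∑ c, w c t = 0)
    (d : D) (t : T) (hpos : 0 < M.load d t w) :
    ∃ e, M.load e t w < 0 ∧ ∃ γ, M.IsConformingMove γ w ∧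
      ∀ d', M.load d' t γ = (if d = d' then 1 else 0) - (if e = d' then 1 else 0) := by
  let F : (C × T) ⊕ C → ℝ := Sum.elim (fun a => w a.1 a.2) fun c => ∑ t, w c t
  obtain ⟨u, hu, f, hf, hout⟩ := exists_unit_flow (M.arcSource t) M.arcTarget F
    (.inr (.inr (.inr d))) (by simpa [netOutflow_typeDistrict, F] using hpos)
  -- Only the copies of `t` can have a nonzero net outflow.
  obtain ⟨e, rfl⟩ : ∃ e, u = .inr (.inr (.inr e)) := by
    rcases u with c | d' | t' | e
    · simp [netOutflow_school, F] at hu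
    · rw [netOutflow_district] at hu
      have := hD d'
      rw [Finset.sum_comm] at this
      simp [F, this] at hu
    · rw [netOutflow_type] at hu
      simp [F, hT] at hu
    · exact ⟨e, rfl⟩
  have hschool : ∀ c, f (.inr c) = ∑ t, f (.inl (c, t)) := fun c => by
    have := hout (.inl c)
    rw [netOutflow_school] at this
    simpa [sub_eq_zero] using this
  have hload : ∀ d', M.load d' t (fun c t => f (.inl (c, t))) =
      (if d = d' then 1 else 0) - (if e = d' then 1 else 0) := fun d' => by
    have := hout (.inr (.inr (.inr d')))
    rw [netOutflow_typeDistrict] at this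
    simpa using this
  refine ⟨e, by simpa [netOutflow_typeDistrict, F] using hu, fun c t => f (.inl (c, t)),
    ⟨fun c t => hf (.inl (c, t)), fun c => ?_, fun d' => ?_, fun t' => ?_⟩, hload⟩
  · rw [← hschool]
    exact hf (.inr c)
  · have := hout (.inr (.inl d'))
    rw [netOutflow_district] at this
    rw [Finset.sum_comm]
    simpa [hschool] using this
  · by_cases ht : t' = t
    · subst ht
      rw [← M.sum_load t' fun c t => f (.inl (c, t))]
      simp [hload]
    · have := hout (.inr (.inr (.inl t')))
      rw [netOutflow_type] at this
      simpa [ht] using this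

theorem exists_conformingMove_of_neg (w : C → T → ℝ)
    (hD : ∀ d, ∑ t, ∑ c with M.schoolDistrict c = d, w c t = 0) (hT : ∀ t, ∑ c, w c t = 0)
    (d : D) (t : T) (hneg : M.load d t w < 0) :
    ∃ e, 0 < M.load e t w ∧ ∃ γ, M.IsConformingMove γ w ∧
      ∀ d', M.load d' t γ = (if e = d' then 1 else 0) - (if d = d' then 1 else 0) := by
  obtain ⟨e, he, γ, hγ, hload⟩ := M.exists_conformingMove_of_pos (-w) (by simpa using hD)
    (by simpa using hT) d t (by simpa [load_neg] using hneg)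
  refine ⟨e, by simpa [load_neg] using he, -γ, by simpa using hγ.negate, fun d' => ?_⟩
  rw [load_neg, hload, neg_sub]

variable [Fintype S]

/-- `x` is an integral feasible point of the linear program. -/
def IntegralFeasible (ceil : C → T → ℕ) (x : C → T → ℤ) : Prop :=
  M.LPFeasible ceil fun c t => (x c t : ℝ)

variable {M} {ceil : C → T → ℕ} {x : C → T → ℤ} {y : C → T → ℝ}

theorem IntegralFeasible.add_move (hx : M.IntegralFeasible ceil x) (hy : M.LPFeasible ceil y)
    {γ : C → T → ℤ} (hγ : M.IsConformingMove γ fun c t => y c t - x c t) :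
    M.IntegralFeasible ceil (x + γ) where
  nonneg c t := by
    have := (hγ.entry c t).le_add (l := 0) (by simpa using hx.nonneg c t)
      (by simpa using hy.nonneg c t)
    simpa using this
  district_total d := by
    have h : ∑ t, ∑ c with M.schoolDistrict c = d, (γ c t : ℝ) = 0 := by
      exact_mod_cast hγ.district d
    have := hx.district_total d
    simp [Finset.sum_add_distrib, h, this]
  type_total t := by
    have h : ∑ c, (γ c t : ℝ) = 0 := by exact_mod_cast hγ.type t
    have := hx.type_total t
    simp [Finset.sum_add_distrib, h, this]
  capacity_le c := by
    have h := hγ.school c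
    rw [Finset.sum_sub_distrib] at h
    have := ConformsTo.add_le (m := ∑ t, x c t) (u := M.capacity c) (by simpa using h)
      (by simpa using hx.capacity_le c) (by simpa using hy.capacity_le c)
    simpa [Finset.sum_add_distrib] using this
  ceiling_le c t := by
    have := (hγ.entry c t).add_le (u := ceil c t) (by simpa using hx.ceiling_le c t)
      (by simpa using hy.ceiling_le c t)
    simpa using this

theorem LPFeasible.sub_district_total {z : C → T → ℝ} (hy : M.LPFeasible ceil y)
    (hz : M.LPFeasible ceil z) (d : D) :
    ∑ t, ∑ c with M.schoolDistrict c = d, (y c t - z c t) = 0 := by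
  simp [Finset.sum_sub_distrib, hy.district_total, hz.district_total]

theorem LPFeasible.sub_type_total {z : C → T → ℝ} (hy : M.LPFeasible ceil y)
    (hz : M.LPFeasible ceil z) (t : T) : ∑ c, (y c t - z c t) = 0 := by
  simp [Finset.sum_sub_distrib, hy.type_total, hz.type_total]

theorem load_sub_intCast (d : D) (t : T) :
    M.load d t (fun c t => y c t - x c t) = M.load d t y - (M.load d t x : ℤ) := by
  simp [load, Finset.sum_sub_distrib]

theorem IntegralFeasible.exists_raise (hx : M.IntegralFeasible ceil x)
    (hy : M.LPFeasible ceil y) (d : D) (t : T) (h : (M.load d t x : ℤ) < M.load d t y) :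
    ∃ e, M.load e t y < (M.load e t x : ℤ) ∧ ∃ x', M.IntegralFeasible ceil x' ∧
      ∀ d', M.load d' t x' =
        M.load d' t x + ((if d = d' then 1 else 0) - (if e = d' then 1 else 0)) := by
  obtain ⟨e, he, γ, hγ, hload⟩ := M.exists_conformingMove_of_pos (fun c t => y c t - x c t)
    (hy.sub_district_total hx) (hy.sub_type_total hx) d t
    (by rw [load_sub_intCast]; linarith)
  rw [load_sub_intCast] at he
  exact ⟨e, by linarith, x + γ, hx.add_move hy hγ, fun d' => by rw [load_add, hload]⟩

theorem IntegralFeasible.exists_lower (hx : M.IntegralFeasible ceil x)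
    (hy : M.LPFeasible ceil y) (d : D) (t : T) (h : M.load d t y < (M.load d t x : ℤ)) :
    ∃ e, (M.load e t x : ℤ) < M.load e t y ∧ ∃ x', M.IntegralFeasible ceil x' ∧
      ∀ d', M.load d' t x' =
        M.load d' t x + ((if e = d' then 1 else 0) - (if d = d' then 1 else 0)) := by
  obtain ⟨e, he, γ, hγ, hload⟩ := M.exists_conformingMove_of_neg (fun c t => y c t - x c t)
    (hy.sub_district_total hx) (hy.sub_type_total hx) d t
    (by rw [load_sub_intCast]; linarith)
  rw [load_sub_intCast] at he
  exact ⟨e, by linarith, x + γ, hx.add_move hy hγ, fun d' => by rw [load_add, hload]⟩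

/-! ### Integral optima, and joint optima in two districts -/

theorem IntegralFeasible.load_nonneg (hx : M.IntegralFeasible ceil x) (d : D) (t : T) :
    0 ≤ M.load d t x :=
  Finset.sum_nonneg fun c _ => by exact_mod_cast hx.nonneg c t

theorem IntegralFeasible.load_le (hx : M.IntegralFeasible ceil x) (d : D) (t : T) :
    M.load d t x ≤ M.residents d := by
  have h1 : M.load d t x ≤ ∑ t, M.load d t x :=
    Finset.single_le_sum (f := fun t => M.load d t x) (fun t _ => hx.load_nonneg d t)
      (Finset.mem_univ t)
  have h2 : ∑ t, M.load d t x = M.residents d := by exact_mod_cast hx.district_total d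
  rwa [h2] at h1

theorem IntegralFeasible.exists_max (hx : M.IntegralFeasible ceil x) (d : D) (t : T) :
    ∃ x', M.IntegralFeasible ceil x' ∧ ∀ y, M.LPFeasible ceil y →
      M.load d t y ≤ (M.load d t x' : ℤ) := by
  obtain ⟨_, ⟨x', hx', rfl⟩, hmax⟩ := Int.exists_greatest_of_bdd
    (P := fun n => ∃ x', M.IntegralFeasible ceil x' ∧ M.load d t x' = n)
    ⟨M.residents d, by rintro _ ⟨x', hx', rfl⟩; exact hx'.load_le d t⟩ ⟨_, x, hx, rfl⟩
  refine ⟨x', hx', fun y hy => ?_⟩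
  by_contra! hlt
  obtain ⟨e, he, x'', hx'', hload⟩ := hx'.exists_raise hy d t hlt
  have hed : e ≠ d := by
    rintro rfl
    linarith
  have := hmax _ ⟨x'', hx'', hload d⟩
  simp [hed] at this

theorem IntegralFeasible.exists_min (hx : M.IntegralFeasible ceil x) (d : D) (t : T) :
    ∃ x', M.IntegralFeasible ceil x' ∧ ∀ y, M.LPFeasible ceil y →
      (M.load d t x' : ℤ) ≤ M.load d t y := by
  obtain ⟨_, ⟨x', hx', rfl⟩, hmin⟩ := Int.exists_least_of_bdd
    (P := fun n => ∃ x', M.IntegralFeasible ceil x' ∧ M.load d t x' = n)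
    ⟨0, by rintro _ ⟨x', hx', rfl⟩; exact hx'.load_nonneg d t⟩ ⟨_, x, hx, rfl⟩
  refine ⟨x', hx', fun y hy => ?_⟩
  by_contra! hlt
  obtain ⟨e, he, x'', hx'', hload⟩ := hx'.exists_lower hy d t hlt
  have hed : e ≠ d := by
    rintro rfl
    linarith
  have := hmin _ ⟨x'', hx'', hload d⟩
  simp [hed] at this

/-- The number of type-`t` students in `d` can be maximized and that in `d' ≠ d` minimized by the
same integral point: among the maximizers for `d`, one that is minimal for `d'` can be lowered in
`d'` only by a move that raises some third district, which keeps the maximum for `d`. -/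
theorem IntegralFeasible.exists_max_min (hx : M.IntegralFeasible ceil x) {d d' : D} (hd : d ≠ d')
    (t : T) : ∃ x', M.IntegralFeasible ceil x' ∧ ∀ y, M.LPFeasible ceil y →
      M.load d t y ≤ (M.load d t x' : ℤ) ∧ (M.load d' t x' : ℤ) ≤ M.load d' t y := by
  obtain ⟨x₀, hx₀, hmax⟩ := hx.exists_max d t
  obtain ⟨_, ⟨x', hx', hmax', rfl⟩, hmin⟩ := Int.exists_least_of_bdd
    (P := fun n => ∃ x', M.IntegralFeasible ceil x' ∧
      (∀ y, M.LPFeasible ceil y → M.load d t y ≤ (M.load d t x' : ℤ)) ∧ M.load d' t x' = n)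
    ⟨0, by rintro _ ⟨x', hx', -, rfl⟩; exact hx'.load_nonneg d' t⟩ ⟨_, x₀, hx₀, hmax, rfl⟩
  refine ⟨x', hx', fun y hy => ⟨hmax' y hy, ?_⟩⟩
  by_contra! hlt
  obtain ⟨e, he, x'', hx'', hload⟩ := hx'.exists_lower hy d' t hlt
  have hed : e ≠ d := by
    rintro rfl
    linarith [hmax' y hy]
  have hed' : e ≠ d' := by
    rintro rfl
    linarith
  have hkeep : M.load d t x'' = M.load d t x' := by
    simp [hload, hed, hd.symm]
  have := hmin _ ⟨x'', hx'', by rwa [hkeep], hload d'⟩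
  simp [hed'] at this

end Exchange

end Market

namespace Market

section Acceptance

variable {S D C T : Type*} [Fintype S] [Fintype D] [Fintype C] [Fintype T]
  [DecidableEq S] [DecidableEq D] [DecidableEq C] [DecidableEq T] {M : Market S D C T}

/-! ### The outcome of deferred acceptance -/

/-- A good completion ignores rejected contracts: removing contracts that are not chosen does not
change the choice. -/
theorem AdmissionsRule.choose_eq_of_subset {d : D} {g : M.AdmissionsRule d}
    (hsub : g.Substitutable) (hlad : g.LAD) {X Y : Finset (Contract S C)}
    (hX : g.choose Y ⊆ X) (hXY : X ⊆ Y) : g.choose X = g.choose Y :=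
  (Finset.eq_of_subset_of_card_le (fun x hx => hsub X Y hXY x (hX hx) hx) (hlad X Y hXY)).symm

theorem AdmissionsRule.choose_subset_self {d : D} (g : M.AdmissionsRule d)
    (X : Finset (Contract S C)) : g.choose X ⊆ X :=
  (g.choose_subset X).trans (Finset.filter_subset _ _)

theorem AdmissionsRule.district_of_mem_choose {d : D} (g : M.AdmissionsRule d)
    {X : Finset (Contract S C)} {x : Contract S C} (hx : x ∈ g.choose X) :
    M.schoolDistrict x.2 = d :=
  (Finset.mem_filter.1 (g.choose_subset X hx)).2

theorem FeasibleForStudents.mono {X Y : Finset (Contract S C)} (hY : M.FeasibleForStudents Y)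
    (hXY : X ⊆ Y) : M.FeasibleForStudents X :=
  fun x hx y hy => hY x (hXY hx) y (hXY hy)

/-- On a set that is feasible for students, a rule agrees with its completions. -/
theorem AdmissionsRule.IsCompletion.choose_eq {d : D} {f g : M.AdmissionsRule d}
    (h : g.IsCompletion f) {X : Finset (Contract S C)} (hX : M.FeasibleForStudents X) :
    g.choose X = f.choose X :=
  (h X).resolve_right fun hn => hn (hX.mono (g.choose_subset_self X))

variable {Ch : ∀ d, M.AdmissionsRule d} {P : S → Preference C}

theorem mem_accepted {st : DAState S C} {x : Contract S C} :
    x ∈ accepted Ch P st ↔ x ∈ (Ch (M.schoolDistrict x.2)).choose (considered P st) := by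
  simp only [accepted, Finset.mem_biUnion, Finset.mem_univ, true_and,
    AdmissionsRule.choose_inDistrict]
  refine ⟨fun ⟨d, hd⟩ => ?_, fun h => ⟨_, h⟩⟩
  rwa [(Ch d).district_of_mem_choose hd]

theorem inDistrict_accepted (d : D) (st : DAState S C) :
    M.inDistrict d (accepted Ch P st) = (Ch d).choose (considered P st) := by
  ext x
  rw [inDistrict, Finset.mem_filter, mem_accepted]
  refine ⟨fun ⟨h1, h2⟩ => h2 ▸ h1, fun h => ?_⟩
  have hd := (Ch d).district_of_mem_choose h
  subst hd
  exact ⟨h, rfl⟩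

theorem mem_newProposals {st : DAState S C} {x : Contract S C} :
    x ∈ newProposals P st ↔ (∀ y ∈ st.held, y.1 ≠ x.1) ∧ x ∉ st.rejected ∧
      ∀ c, c ≠ x.2 → (x.1, c) ∉ st.rejected → (P x.1).prefers x.2 c := by
  simp [newProposals]

variable (Ch P)

theorem considered_feasibleForStudents (n : ℕ) :
    M.FeasibleForStudents (considered P (daState Ch P n)) := by
  have key : ∀ st : DAState S C, M.FeasibleForStudents st.held →
      M.FeasibleForStudents (considered P st) := by
    intro st hst x hx y hy hxy
    rcases Finset.mem_union.1 hx with hx | hx <;> rcases Finset.mem_union.1 hy with hy | hy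
    · exact hst x hx y hy hxy
    · exact absurd hxy ((mem_newProposals.1 hy).1 x hx)
    · exact absurd hxy.symm ((mem_newProposals.1 hx).1 y hy)
    · obtain ⟨-, hx1, hx2⟩ := mem_newProposals.1 hx
      obtain ⟨-, hy1, hy2⟩ := mem_newProposals.1 hy
      by_contra hne
      obtain ⟨s, c⟩ := x
      obtain ⟨s', c'⟩ := y
      obtain rfl : s = s' := hxy
      have hc : c ≠ c' := fun h => hne (by rw [h])
      exact (P s).irrefl _ ((P s).trans _ _ _ (hx2 c' hc.symm hy1) (hy2 c hc hx1))
  induction n with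
  | zero => exact key _ fun x hx => by simp [daState] at hx
  | succ n ih => exact key _ (ih.mono (accepted_subset_considered Ch P _))

/-- A good completion rejects every contract rejected so far from the set of all contracts
considered so far, which consists of the contracts now considered and those rejected before. -/
theorem notMem_choose_of_mem_rejected {d : D} {g : M.AdmissionsRule d}
    (hcomp : g.IsCompletion (Ch d)) (hsub : g.Substitutable) (hlad : g.LAD) (n : ℕ)
    {x : Contract S C} (hx : x ∈ (daState Ch P n).rejected) :
    x ∉ g.choose (considered P (daState Ch P n) ∪ (daState Ch P n).rejected) := by
  induction n generalizing x with
  | zero => simp [daState] at hx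
  | succ n ih =>
    set st := daState Ch P n with hst
    have hstep : considered P st ∪ st.rejected ⊆
        considered P (daState Ch P (n + 1)) ∪ (daState Ch P (n + 1)).rejected := by
      intro y hy
      simp only [considered, daState, rejections, Finset.mem_union, Finset.mem_sdiff] at hy ⊢
      tauto
    have hxold : x ∈ considered P st ∪ st.rejected := by
      simp only [daState, rejections, Finset.mem_union, Finset.mem_sdiff] at hx ⊢
      tauto
    intro hmem
    have hmem := hsub _ _ hstep x hxold hmem
    have hxn : x ∉ st.rejected := fun h => ih h hmem
    have hgsub : g.choose (considered P st ∪ st.rejected) ⊆ considered P st := fun y hy =>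
      (Finset.mem_union.1 (g.choose_subset_self _ hy)).resolve_right fun h => ih h hy
    rw [← AdmissionsRule.choose_eq_of_subset hsub hlad hgsub Finset.subset_union_left,
      hcomp.choose_eq (considered_feasibleForStudents Ch P n), ← inDistrict_accepted] at hmem
    have hacc := (Finset.mem_filter.1 hmem).1
    simp only [daState, rejections, Finset.mem_union, Finset.mem_sdiff] at hx
    tauto

/-- The outcome is the set of contracts considered in some step without rejections. -/
theorem exists_SPDA_eq : ∃ n, SPDA Ch P = accepted Ch P (daState Ch P n) ∧
    accepted Ch P (daState Ch P n) = considered P (daState Ch P n) := by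
  classical
  have h := Nat.find_spec (exists_no_rejections Ch P)
  exact ⟨Nat.find (exists_no_rejections Ch P), rfl, (accepted_subset_considered Ch P _).antisymm
    (Finset.sdiff_eq_empty_iff_subset.1 h)⟩

theorem exists_prefers_all (p : Preference C) (A : Finset C) (hA : A.Nonempty) :
    ∃ a ∈ A, ∀ b ∈ A, b ≠ a → p.prefers a b := by
  induction hA using Finset.Nonempty.cons_induction with
  | singleton a => exact ⟨a, by simp, fun b hb hne => absurd (Finset.mem_singleton.1 hb) hne⟩
  | cons a A ha hA ih =>
    obtain ⟨m, hm, hbest⟩ := ih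
    have hne : a ≠ m := fun h => ha (h ▸ hm)
    rcases p.total a m hne with h | h
    · refine ⟨a, Finset.mem_cons_self _ _, fun b hb hba => ?_⟩
      have hb := (Finset.mem_cons.1 hb).resolve_left hba
      rcases eq_or_ne b m with rfl | hbm
      · exact h
      · exact p.trans _ _ _ h (hbest b hb hbm)
    · refine ⟨m, Finset.mem_cons_of_mem hm, fun b hb hbm => ?_⟩
      rcases Finset.mem_cons.1 hb with rfl | hb
      · exact h
      · exact hbest b hb hbm

theorem SPDA_feasibleForStudents : M.FeasibleForStudents (SPDA Ch P) := by
  obtain ⟨n, h1, h2⟩ := exists_SPDA_eq Ch P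
  rw [h1, h2]
  exact considered_feasibleForStudents Ch P n

/-- Every district chooses all its contracts from the outcome. -/
theorem choose_SPDA (d : D) : (Ch d).choose (SPDA Ch P) = M.inDistrict d (SPDA Ch P) := by
  obtain ⟨n, h1, h2⟩ := exists_SPDA_eq Ch P
  rw [h1, inDistrict_accepted, h2]

theorem card_inSchool_SPDA_le (hfeas : ∀ d, (Ch d).IsFeasible) (c : C) :
    (M.inSchool c (SPDA Ch P)).card ≤ M.capacity c := by
  refine le_trans (Finset.card_le_card fun x hx => ?_)
    ((hfeas (M.schoolDistrict c) (SPDA Ch P)).2 c)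
  rw [choose_SPDA]
  simp only [inSchool, inDistrict, Finset.mem_filter] at hx ⊢
  exact ⟨⟨hx.1, by rw [hx.2]⟩, hx.2⟩

/-- No student is left unmatched. A student unmatched in the final step would have been rejected by
every school; but the completion rejects such a contract from the set of all contracts ever
considered, so the district also rejects it when it is added to the outcome. -/
theorem SPDA_matches_all (hfeas : ∀ d, (Ch d).IsFeasible)
    (hcompl : ∀ d, (Ch d).HasGoodCompletion) (hunm : AccommodatesUnmatched Ch) (s : S) :
    ∃ c, (s, c) ∈ SPDA Ch P := by
  by_contra! hs
  have hne : ∀ x ∈ SPDA Ch P, x.1 ≠ s := by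
    rintro ⟨s', c⟩ hx rfl
    exact hs c hx
  obtain ⟨c, hc⟩ := hunm s _ ⟨SPDA_feasibleForStudents Ch P,
    card_inSchool_SPDA_le Ch P hfeas⟩ hne
  obtain ⟨n, h1, h2⟩ := exists_SPDA_eq Ch P
  rw [h2] at h1
  rw [h1] at hc hne
  set st := daState Ch P n with hst
  have hrej : ∀ c, (s, c) ∈ st.rejected := by
    classical
    by_contra! hex
    obtain ⟨c₁, hc₁⟩ := hex
    obtain ⟨a, ha, hbest⟩ := exists_prefers_all (P s)
      (Finset.univ.filter fun c => (s, c) ∉ st.rejected)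
      ⟨c₁, by simpa using hc₁⟩
    have : (s, a) ∈ newProposals P st := mem_newProposals.2
      ⟨fun y hy => hne y (Finset.mem_union_left _ hy), (Finset.mem_filter.1 ha).2,
        fun b hb hbr => hbest b (by simpa using hbr) hb⟩
    exact hne _ (Finset.mem_union_right _ this) rfl
  obtain ⟨g, hcomp, hsub, hlad⟩ := hcompl (M.schoolDistrict c)
  have hold := fun x hx => notMem_choose_of_mem_rejected Ch P hcomp hsub hlad n (x := x) hx
  rw [← hst] at hold
  have hff : M.FeasibleForStudents (insert (s, c) (considered P st)) := by
    intro x hx y hy hxy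
    rcases Finset.mem_insert.1 hx with rfl | hx <;> rcases Finset.mem_insert.1 hy with rfl | hy
    · rfl
    · exact absurd hxy.symm (hne y hy)
    · exact absurd hxy (hne x hx)
    · exact considered_feasibleForStudents Ch P n x hx y hy hxy
  have hgsub : g.choose (considered P st ∪ st.rejected) ⊆ insert (s, c) (considered P st) :=
    fun y hy => Finset.mem_insert_of_mem
      ((Finset.mem_union.1 (g.choose_subset_self _ hy)).resolve_right fun h => hold y h hy)
  rw [← hcomp.choose_eq hff, AdmissionsRule.choose_eq_of_subset hsub hlad hgsub
    (Finset.insert_subset (Finset.mem_union_right _ (hrej c)) Finset.subset_union_left)] at hc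
  exact hold _ (hrej c) hc

/-! ### Matchings as integral points of the linear program -/

variable (M)

theorem sum_schoolTypeCount (c : C) (X : Finset (Contract S C)) :
    ∑ t, M.schoolTypeCount c t X = (M.inSchool c X).card := by
  rw [inSchool, Finset.card_eq_sum_card_fiberwise (f := fun x => M.studentType x.1)
    (t := Finset.univ) (fun _ _ => Finset.mem_univ _)]
  simp only [schoolTypeCount, Finset.filter_filter]

theorem sum_districtTypeCount (d : D) (X : Finset (Contract S C)) :
    ∑ t, ∑ c with M.schoolDistrict c = d, M.schoolTypeCount c t X = (M.inDistrict d X).card := by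
  rw [Finset.sum_comm, Finset.sum_congr rfl fun c _ => M.sum_schoolTypeCount c X,
    Finset.card_eq_sum_card_fiberwise (f := fun x : Contract S C => x.2)
    (t := Finset.univ.filter fun c => M.schoolDistrict c = d)
    (fun x hx => by simpa using (Finset.mem_filter.1 hx).2)]
  refine Finset.sum_congr rfl fun c hc => congrArg _ ?_
  ext x
  simp only [inSchool, inDistrict, Finset.mem_filter]
  refine ⟨fun h => ⟨⟨h.1, ?_⟩, h.2⟩, fun h => ⟨h.1.1, h.2⟩⟩
  rw [h.2]
  exact (Finset.mem_filter.1 hc).2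

theorem sum_card_inDistrict (X : Finset (Contract S C)) :
    ∑ d, (M.inDistrict d X).card = X.card :=
  (Finset.card_eq_sum_card_fiberwise fun _ _ => Finset.mem_univ _).symm

theorem sum_residents : ∑ d, M.residents d = Fintype.card S :=
  (Finset.card_eq_sum_card_fiberwise fun _ _ => Finset.mem_univ _).symm

/-- The matching that assigns every student `s` to the school `f s`. -/
def matchingOf (f : S → C) : Finset (Contract S C) :=
  Finset.univ.filter fun x => f x.1 = x.2

theorem card_filter_matchingOf (f : S → C) (p : Contract S C → Prop) [DecidablePred p] :
    ((matchingOf f).filter p).card = (Finset.univ.filter fun s => p (s, f s)).card := by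
  refine Finset.card_bij' (fun x _ => x.1) (fun s _ => (s, f s)) ?_ ?_ ?_ ?_
  · rintro ⟨s, c⟩ h
    simp only [matchingOf, Finset.mem_filter, Finset.mem_univ, true_and] at h ⊢
    rw [h.1]
    exact h.2
  · intro s h
    simpa [matchingOf] using h
  · rintro ⟨s, c⟩ h
    simp only [matchingOf, Finset.mem_filter, Finset.mem_univ, true_and] at h
    rw [← h.1]
  · intro s h
    rfl

theorem card_matchingOf (f : S → C) : (matchingOf f).card = Fintype.card S := by
  have := card_filter_matchingOf f fun _ => True
  rwa [Finset.filter_true, Finset.filter_true, Finset.card_univ] at this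

theorem matchingOf_feasibleForStudents (f : S → C) : M.FeasibleForStudents (matchingOf f) := by
  rintro ⟨s, c⟩ hx ⟨s', c'⟩ hy (rfl : s = s')
  simp only [matchingOf, Finset.mem_filter, Finset.mem_univ, true_and] at hx hy
  rw [← hx, ← hy]

theorem sum_schoolTypeCount_matchingOf (f : S → C) (t : T) :
    ∑ c, M.schoolTypeCount c t (matchingOf f) = M.typeCount t := by
  simp only [schoolTypeCount, card_filter_matchingOf]
  rw [typeCount, Finset.card_eq_sum_card_fiberwise (f := f) (t := Finset.univ)
    (fun _ _ => Finset.mem_univ _)]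
  simp only [Finset.filter_filter, and_comm]

theorem exists_SPDA_eq_matchingOf (hfeas : ∀ d, (Ch d).IsFeasible)
    (hcompl : ∀ d, (Ch d).HasGoodCompletion) (hunm : AccommodatesUnmatched Ch) :
    ∃ f, SPDA Ch P = matchingOf f := by
  choose f hf using SPDA_matches_all Ch P hfeas hcompl hunm
  refine ⟨f, ?_⟩
  ext ⟨s, c⟩
  simp only [matchingOf, Finset.mem_filter, Finset.mem_univ, true_and]
  refine ⟨fun h => ?_, fun h => h ▸ hf s⟩
  exact congrArg Prod.snd (SPDA_feasibleForStudents Ch P _ (hf s) _ h rfl)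

/-- All students are matched and no district exceeds the number of its residents, so every district
is assigned exactly that number. -/
theorem card_inDistrict_SPDA (hfeas : ∀ d, (Ch d).IsFeasible)
    (hcompl : ∀ d, (Ch d).HasGoodCompletion) (hrat : ∀ d, (Ch d).IsRationed)
    (hunm : AccommodatesUnmatched Ch) (d : D) :
    (M.inDistrict d (SPDA Ch P)).card = M.residents d := by
  have hle : ∀ d ∈ Finset.univ, (M.inDistrict d (SPDA Ch P)).card ≤ M.residents d := by
    intro d _
    have := hrat d _ (SPDA_feasibleForStudents Ch P) d
    rw [choose_SPDA] at this
    simpa [inDistrict, Finset.filter_filter] using this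
  obtain ⟨f, hf⟩ := exists_SPDA_eq_matchingOf M Ch P hfeas hcompl hunm
  refine (Finset.sum_eq_sum_iff_of_le hle).1 ?_ d (Finset.mem_univ d)
  rw [sum_card_inDistrict, sum_residents, hf, card_matchingOf]

theorem SPDA_lpFeasible {ceil : C → T → ℕ} (hfeas : ∀ d, (Ch d).IsFeasible)
    (hcompl : ∀ d, (Ch d).HasGoodCompletion) (hceil : ∀ d, (Ch d).HasCeilings ceil)
    (hrat : ∀ d, (Ch d).IsRationed) (hunm : AccommodatesUnmatched Ch) :
    M.LPFeasible ceil fun c t => (M.schoolTypeCount c t (SPDA Ch P) : ℝ) where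
  nonneg c t := Nat.cast_nonneg _
  district_total d := by
    rw [← card_inDistrict_SPDA M Ch P hfeas hcompl hrat hunm d, ← sum_districtTypeCount]
    push_cast
    rfl
  type_total t := by
    obtain ⟨f, hf⟩ := exists_SPDA_eq_matchingOf M Ch P hfeas hcompl hunm
    rw [← M.sum_schoolTypeCount_matchingOf f, hf]
    push_cast
    rfl
  capacity_le c := by
    have := card_inSchool_SPDA_le Ch P hfeas c
    rw [← sum_schoolTypeCount] at this
    exact_mod_cast this
  ceiling_le c t := by
    have h := hceil (M.schoolDistrict c) _ (SPDA_feasibleForStudents Ch P) c t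
    have heq : M.schoolTypeCount c t (M.inDistrict (M.schoolDistrict c) (SPDA Ch P)) =
        M.schoolTypeCount c t (SPDA Ch P) := by
      rw [schoolTypeCount, schoolTypeCount, inDistrict, Finset.filter_filter]
      refine congrArg _ (Finset.filter_congr fun x _ => ?_)
      exact ⟨fun h => h.2, fun h => ⟨by rw [h.1], h⟩⟩
    rw [choose_SPDA, heq] at h
    exact_mod_cast h

theorem SPDA_integralFeasible {ceil : C → T → ℕ} (hfeas : ∀ d, (Ch d).IsFeasible)
    (hcompl : ∀ d, (Ch d).HasGoodCompletion) (hceil : ∀ d, (Ch d).HasCeilings ceil)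
    (hrat : ∀ d, (Ch d).IsRationed) (hunm : AccommodatesUnmatched Ch) :
    M.IntegralFeasible ceil fun c t => (M.schoolTypeCount c t (SPDA Ch P) : ℤ) := by
  simpa [IntegralFeasible] using SPDA_lpFeasible M Ch P hfeas hcompl hceil hrat hunm

/-! ### Integral points as outcomes of deferred acceptance -/

/-- A preference order with `c₀` at the top. -/
noncomputable def topPreference (c₀ : C) : Preference C :=
  let rank : C → ℕ := fun c => if c = c₀ then 0 else (Fintype.equivFin C c : ℕ) + 1
  { prefers := fun a b => rank a < rank b
    irrefl := fun _ => lt_irrefl _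
    trans := fun _ _ _ => lt_trans
    total := fun a b hab => by
      refine lt_or_gt_of_ne fun h => hab ?_
      simp only [rank] at h
      split_ifs at h with h1 h2 h2
      · rw [h1, h2]
      · exact (Fintype.equivFin C).injective (Fin.ext (by omega)) }

theorem topPreference_prefers {c₀ c : C} (h : c ≠ c₀) : (topPreference c₀).prefers c₀ c := by
  simp [topPreference, h]

/-- If all students rank their schools in `f` at the top, and every district would admit them, then
deferred acceptance stops in its first step with the matching `f`. -/
theorem SPDA_topPreference (f : S → C)
    (hf : ∀ d, (Ch d).choose (matchingOf f) = M.inDistrict d (matchingOf f)) :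
    SPDA Ch (fun s => topPreference (f s)) = matchingOf f := by
  classical
  set P : S → Preference C := fun s => topPreference (f s) with hP
  have hcons : considered P (daState Ch P 0) = matchingOf f := by
    ext ⟨s, c⟩
    simp only [considered, daState, Finset.empty_union, mem_newProposals, matchingOf,
      Finset.mem_filter, Finset.mem_univ, true_and, Finset.notMem_empty, not_false_eq_true,
      forall_true_left, IsEmpty.forall_iff, implies_true]
    constructor
    · intro h
      by_contra hne
      exact (P s).irrefl _ ((P s).trans _ _ _ (h (f s) hne) (topPreference_prefers (Ne.symm hne)))
    · rintro rfl b hb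
      exact topPreference_prefers hb
  have hacc : accepted Ch P (daState Ch P 0) = matchingOf f := by
    ext x
    rw [mem_accepted, hcons, hf]
    simp [inDistrict]
  have hfind : Nat.find (exists_no_rejections Ch P) = 0 :=
    (Nat.find_eq_zero _).2 (by rw [rejections, hcons, hacc, Finset.sdiff_self])
  have : SPDA Ch P = accepted Ch P (daState Ch P (Nat.find (exists_no_rejections Ch P))) := rfl
  rw [this, hfind, hacc]

variable {M}

/-- A weakly acceptant rule chooses everything if no bound is exceeded: a rejection would leave
every bound that involves the rejected contract slack. -/
theorem AdmissionsRule.WeaklyAcceptant.choose_eq {ceil : C → T → ℕ} {d : D}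
    {g : M.AdmissionsRule d} (hacc : g.WeaklyAcceptant ceil) {X : Finset (Contract S C)}
    (hX : M.FeasibleForStudents X) (hcap : ∀ c, (M.inSchool c X).card ≤ M.capacity c)
    (hres : (M.inDistrict d X).card ≤ M.residents d)
    (hceil : ∀ c t, M.schoolTypeCount c t X ≤ ceil c t) : g.choose X = M.inDistrict d X := by
  refine (g.choose_subset X).antisymm fun x hx => ?_
  by_contra hxg
  have hlt : ∀ (p : Contract S C → Prop) [DecidablePred p], p x →
      ((g.choose X).filter p).card < (X.filter p).card := fun p _ hp =>
    Finset.card_lt_card <| Finset.ssubset_iff_of_subset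
      (Finset.filter_subset_filter _ (g.choose_subset_self X)) |>.2
      ⟨x, Finset.mem_filter.2 ⟨(Finset.mem_filter.1 hx).1, hp⟩,
        fun h => hxg (Finset.mem_filter.1 h).1⟩
  rcases hacc X hX x hx hxg with h | h | h
  · exact absurd (hlt (fun y => y.2 = x.2) rfl) (by
      have := hcap x.2
      simp only [inSchool] at h this
      omega)
  · exact absurd (hlt (fun y => M.schoolDistrict y.2 = d) (Finset.mem_filter.1 hx).2) (by
      simp only [inDistrict] at h hres
      omega)
  · exact absurd (hlt (fun y => y.2 = x.2 ∧ M.studentType y.1 = M.studentType x.1) ⟨rfl, rfl⟩) (by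
      have := hceil x.2 (M.studentType x.1)
      simp only [schoolTypeCount] at h this
      omega)

/-- Counts with the right type totals are realized by an assignment of students to schools. -/
theorem exists_assignment (x : C → T → ℕ) (hx : ∀ t, ∑ c, x c t = M.typeCount t) :
    ∃ f : S → C, ∀ c t, M.schoolTypeCount c t (matchingOf f) = x c t := by
  have e : ∀ t, Nonempty ({s : S // M.studentType s = t} ≃ Σ c, Fin (x c t)) := fun t =>
    Fintype.card_eq.1 (by
      rw [Fintype.card_sigma]
      simp only [Fintype.card_fin, hx]
      exact Fintype.card_subtype _)
  let e := fun t => (e t).some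
  refine ⟨fun s => (e (M.studentType s) ⟨s, rfl⟩).1, fun c t => ?_⟩
  rw [schoolTypeCount, card_filter_matchingOf, ← Fintype.card_fin (x c t)]
  rw [← Finset.card_univ]
  refine (Finset.card_bij (fun i _ => ((e t).symm ⟨c, i⟩ : S)) ?_ ?_ ?_).symm
  · intro i _
    rcases hs2 : (e t).symm ⟨c, i⟩ with ⟨s, rfl⟩
    have := (Equiv.symm_apply_eq _).1 hs2
    simp [← this]
  · intro i _ j _ hij
    have := (e t).symm.injective (Subtype.ext hij)
    simpa using this
  · intro s hs
    obtain ⟨hc, rfl⟩ := (Finset.mem_filter.1 hs).2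
    subst hc
    exact ⟨(e (M.studentType s) ⟨s, rfl⟩).2, Finset.mem_univ _, by simp⟩

theorem IntegralFeasible.exists_SPDA {ceil : C → T → ℕ} (hacc : ∀ d, (Ch d).WeaklyAcceptant ceil)
    {x : C → T → ℤ} (hx : M.IntegralFeasible ceil x) :
    ∃ P, ∀ c t, (M.schoolTypeCount c t (SPDA Ch P) : ℤ) = x c t := by
  have hnat : ∀ c t, ∃ n : ℕ, (n : ℤ) = x c t := fun c t =>
    ⟨(x c t).toNat, Int.toNat_of_nonneg (by exact_mod_cast hx.nonneg c t)⟩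
  choose n hn using hnat
  have hnR : ∀ c t, (x c t : ℝ) = n c t := fun c t => by rw [← hn]; simp
  obtain ⟨f, hf⟩ := M.exists_assignment n fun t => by
    have := hx.type_total t
    simp only [hnR] at this
    exact_mod_cast this
  refine ⟨fun s => topPreference (f s), fun c t => ?_⟩
  rw [SPDA_topPreference, hf, hn]
  refine fun d => (hacc d).choose_eq (M.matchingOf_feasibleForStudents f) (fun c => ?_) ?_ ?_
  · have := hx.capacity_le c
    simp only [hnR] at this
    rw [← sum_schoolTypeCount]
    simp only [hf]
    exact_mod_cast this
  · have := hx.district_total d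
    simp only [hnR] at this
    rw [← sum_districtTypeCount]
    simp only [hf]
    exact_mod_cast this.le
  · intro c t
    have := hx.ceiling_le c t
    rw [hnR] at this
    rw [hf]
    exact_mod_cast this

end Acceptance

end Market

theorem theorem3 {S D C T : Type*} [Fintype S] [Fintype D] [Fintype C] [Fintype T]
    [DecidableEq S] [DecidableEq D] [DecidableEq C] [DecidableEq T]
    (M : Market S D C T) (hk : ∀ d, 0 < M.residents d)
    (ceil : C → T → ℕ) (Ch : ∀ d, M.AdmissionsRule d)
    (hfeas : ∀ d, (Ch d).IsFeasible)
    (hcompl : ∀ d, (Ch d).HasGoodCompletion)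
    (hceil : ∀ d, (Ch d).HasCeilings ceil)
    (hrat : ∀ d, (Ch d).IsRationed)
    (hacc : ∀ d, (Ch d).WeaklyAcceptant ceil)
    (hunm : Market.AccommodatesUnmatched Ch)
    (α : ℝ) (hα : α ∈ Set.Icc (0 : ℝ) 1) :
    (∀ d t, IsLeast (M.lpValues ceil d t) (M.impliedFloor ceil d t) ∧
      IsGreatest (M.lpValues ceil d t) (M.impliedCeiling ceil d t)) ∧
    (M.SatisfiesDiversity α (Market.SPDA Ch) ↔
      ∀ (t : T) (d d' : D), d ≠ d' →
        M.impliedCeiling ceil d t / (M.residents d : ℝ) -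
          M.impliedFloor ceil d' t / (M.residents d' : ℝ) ≤ α) := by
  have hpoint := fun P => M.SPDA_integralFeasible Ch P hfeas hcompl hceil hrat hunm
  have hcard := fun P => M.card_inDistrict_SPDA Ch P hfeas hcompl hrat hunm
  -- The linear program is feasible: if there is a student, there is a school, and so a profile.
  obtain ⟨P₀⟩ : Nonempty (S → Preference C) := by
    refine ⟨fun s => ?_⟩
    have : Nonempty C := ⟨(hunm s ∅ ⟨by simp [Market.FeasibleForStudents],
      by simp [Market.inSchool]⟩ (by simp)).choose⟩
    exact Market.topPreference (Classical.arbitrary C)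
  have hleast : ∀ d t, IsLeast (M.lpValues ceil d t) (M.impliedFloor ceil d t) := by
    intro d t
    obtain ⟨x, hx, hmin⟩ := (hpoint P₀).exists_min d t
    have h : IsLeast (M.lpValues ceil d t) ((M.load d t x : ℤ) : ℝ) := by
      refine ⟨⟨_, hx, (M.load_intCast d t x).symm⟩, ?_⟩
      rintro _ ⟨y, hy, rfl⟩
      exact hmin y hy
    rwa [Market.impliedFloor, h.csInf_eq]
  have hgreatest : ∀ d t, IsGreatest (M.lpValues ceil d t) (M.impliedCeiling ceil d t) := by
    intro d t
    obtain ⟨x, hx, hmax⟩ := (hpoint P₀).exists_max d t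
    have h : IsGreatest (M.lpValues ceil d t) ((M.load d t x : ℤ) : ℝ) := by
      refine ⟨⟨_, hx, (M.load_intCast d t x).symm⟩, ?_⟩
      rintro _ ⟨y, hy, rfl⟩
      exact hmax y hy
    rwa [Market.impliedCeiling, h.csSup_eq]
  have hratio : ∀ P d t, M.typeRatio d t (Market.SPDA Ch P) =
      (M.districtTypeCount d t (Market.SPDA Ch P) : ℝ) / (M.residents d : ℝ) := by
    intro P d t
    rw [Market.typeRatio, hcard]
  have hkR : ∀ d, (0 : ℝ) < M.residents d := fun d => by exact_mod_cast hk d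
  refine ⟨fun d t => ⟨hleast d t, hgreatest d t⟩, fun hdiv t d d' hd => ?_, fun h P d d' t => ?_⟩
  · obtain ⟨x, hx, hopt⟩ := (hpoint P₀).exists_max_min hd t
    obtain ⟨P, hP⟩ := Market.IntegralFeasible.exists_SPDA Ch hacc hx
    have hcount : ∀ e, (M.districtTypeCount e t (Market.SPDA Ch P) : ℝ) = (M.load e t x : ℤ) := by
      intro e
      have : (M.districtTypeCount e t (Market.SPDA Ch P) : ℤ) = M.load e t x := by
        simp only [Market.districtTypeCount, Market.load, ← hP]
        push_cast
        rfl
      exact_mod_cast this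
    have hmain := hdiv P d d' t
    rw [hratio, hratio, hcount, hcount] at hmain
    obtain ⟨y, hy, hyv⟩ := (hgreatest d t).1
    obtain ⟨z, hz, hzv⟩ := (hleast d' t).1
    have h1 : M.impliedCeiling ceil d t ≤ (M.load d t x : ℤ) := hyv ▸ (hopt y hy).1
    have h2 : (M.load d' t x : ℤ) ≤ M.impliedFloor ceil d' t := hzv ▸ (hopt z hz).2
    have h3 := div_le_div_of_nonneg_right h1 (hkR d).le
    have h4 := div_le_div_of_nonneg_right h2 (hkR d').le
    linarith
  · rcases eq_or_ne d d' with rfl | hd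
    · simpa using hα.1
    · have hmem : ∀ e, (M.districtTypeCount e t (Market.SPDA Ch P) : ℝ) ∈ M.lpValues ceil e t :=
        fun e => ⟨_, hpoint P, by simp [Market.districtTypeCount]⟩
      rw [hratio, hratio]
      have h3 := div_le_div_of_nonneg_right ((hgreatest d t).2 (hmem d)) (hkR d).le
      have h4 := div_le_div_of_nonneg_right ((hleast d' t).2 (hmem d')) (hkR d').le
      linarith [h t d d' hd]
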